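/- Let $n\ge 0$, let $\alpha>0$ and let $A$ be a real $n\times n$ nonsingular $M$-matrix, that is, $A_{i,j}\le 0$ for all $i\neq j$, $A$ is invertible, and all entries of $A^{-1}$ are nonnegative. Let $a_1,\dots,a_n$ be the diagonal entries of $A$, put $D=\mathrm{diag}(a_1,\dots,a_n)$ and write $A=D-B$. Write $|M|$ for the determinant of a square matrix $M$. For an $m\times m$ matrix $M$ let $$|M|_\alpha=\sum_{\pi}\alpha^{c(\pi)}\prod_{p=1}^m M_{p,\pi(p)},$$ where $\pi$ runs over all permutations of $\{1,\dots,m\}$ and $c(\pi)$ is the number of cycles of $\pi$, fixed points included (so $|M|_\alpha=1$ if $m=0$). For $\mathbf k=(k_1,\dots,k_n)\in\mathbb N^n$, where $\mathbb N=\{0,1,2,\dots\}$, let $B(\mathbf k)$ be the square matrix of size $k_1+\cdots+k_n$ with entries $B_{i_p,i_q}$, where $(i_1,i_2,\dots)$ is the sequence $1,\dots,1,2,\dots,2,\dots,n,\dots,n$ in which each $i$ is repeated $k_i$ times. Put $$w(\mathbf k)=\frac{|A|^\alpha}{\prod_{i=1}^n a_i^\alpha}\,\frac{|B(\mathbf k)|_\alpha}{\prod_{i=1}^n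 a_i^{k_i}k_i!}.$$ Then $w(\mathbf k)\ge 0$ for all $\mathbf k\in\mathbb N^n$ and $\sum_{\mathbf k}w(\mathbf k)=1$, so that there are, on some probability space, an $\mathbb N^n$-valued random variable $Z$ with $P(Z=\mathbf k)=w(\mathbf k)$ for all $\mathbf k$, and real random variables $\xi^{(\mathbf k,i)}$ ($\mathbf k\in\mathbb N^n$, $1\le i\le n$) such that $\xi^{(\mathbf k,i)}$ has the gamma distribution with shape $\alpha+k_i$ and rate $a_i$, and $Z$ and all the $\xi^{(\mathbf k,i)}$ are independent. Moreover, $|A|>0$ and $|A+S|>0$ for every $S=\mathrm{diag}(s_1,\dots,s_n)$ with $s_1,\dots,s_n\ge 0$. For any such $Z$ and $\xi^{(\mathbf k,i)}$ on any probability space, the random vector $X=(X_1,\dots,X_n)$ with $$X_i=\xi^{(Z,i)}=\sum_{\mathbf k}1_{\{Z=\mathbf k\}}\,\xi^{(\mathbf k,i)}$$ satisfies, for every such $S$, $$E\Bigl(e^{-\sum_{i=1}^n s_iX_i}\Bigr)=\frac{|A|^\alpha}{|A+S|^\alpha}.$$ -/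

import Mathlib

open MeasureTheory ProbabilityTheory

/-- `A` is a nonsingular `M`-matrix: its off-diagonal entries are nonpositive, it is invertible,
and all the entries of its inverse are nonnegative. -/
structure IsNonsingularMMatrix {n : ℕ} (A : Matrix (Fin n) (Fin n) ℝ) : Prop where
  offDiag_nonpos : ∀ i j, i ≠ j → A i j ≤ 0
  nonsingular : IsUnit A.det
  inv_nonneg : ∀ i j, 0 ≤ A⁻¹ i j

/-- The number of cycles of a permutation, each fixed point being counted as a cycle
(Mathlib's `cycleType` only lists the lengths of the cycles of length at least two). -/
def numCycles {ι : Type*} [Fintype ι] [DecidableEq ι] (π : Equiv.Perm ι) : ℕ :=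
  Multiset.card π.cycleType + (Finset.univ.filter fun i => π i = i).card

/-- The `α`-permanent `∑ π, α ^ c(π) * ∏ i, m_{i, π(i)}` of a square matrix. It is `1` for the
empty matrix. -/
noncomputable def alphaPermanent {ι : Type*} [Fintype ι] [DecidableEq ι] (α : ℝ)
    (M : Matrix ι ι ℝ) : ℝ :=
  ∑ π : Equiv.Perm ι, α ^ numCycles π * ∏ i, M i (π i)

/-- The matrix `C(k)` of size `k₁ + ⋯ + kₙ`, in which the index `i` is repeated `kᵢ` times.
Its rows and columns are indexed by the pairs `(i, r)` with `r < kᵢ`; listing these pairs in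
lexicographic order gives the usual numbering `1, …, k₁ + ⋯ + kₙ`. -/
def repeatedMatrix {n : ℕ} (C : Matrix (Fin n) (Fin n) ℝ) (k : Fin n → ℕ) :
    Matrix ((i : Fin n) × Fin (k i)) ((i : Fin n) × Fin (k i)) ℝ :=
  Matrix.of fun p q => C p.1 q.1

/-- The matrix `B` in the decomposition `A = D - B`, where `D` is the diagonal part of `A`. -/
def offDiagPart {n : ℕ} (A : Matrix (Fin n) (Fin n) ℝ) : Matrix (Fin n) (Fin n) ℝ :=
  Matrix.diagonal (fun i => A i i) - A

/-- The weight `|A|^α / ∏ aᵢ^α * |B(k)|_α / ∏ (aᵢ^{kᵢ} kᵢ!)`, with `aᵢ` the diagonal entries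
of `A`. -/
noncomputable def mixtureWeight {n : ℕ} (α : ℝ) (A : Matrix (Fin n) (Fin n) ℝ)
    (k : Fin n → ℕ) : ℝ :=
  A.det ^ α / (∏ i, A i i ^ α) *
    (alphaPermanent α (repeatedMatrix (offDiagPart A) k) /
      ∏ i, (A i i ^ k i * (Nat.factorial (k i) : ℝ)))

/-- On the probability space `(Ω, P)`, the random vector `Z` with values in `ℕⁿ` has the point
probabilities `mixtureWeight α A`, each `ξ k i` is gamma distributed with shape `α + kᵢ` and rate
`aᵢ`, and `Z` and all the `ξ k i` are independent: the `ξ k i` are mutually independent,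
and `Z` is independent of the whole family `ξ`. -/
structure IsMixtureFamily {n : ℕ} {Ω : Type*} [MeasurableSpace Ω] (P : Measure Ω) (α : ℝ)
    (A : Matrix (Fin n) (Fin n) ℝ) (Z : Ω → Fin n → ℕ)
    (ξ : (Fin n → ℕ) → Fin n → Ω → ℝ) : Prop where
  measurable_Z : Measurable Z
  prob_Z : ∀ k, P.real {ω | Z ω = k} = mixtureWeight α A k
  measurable_ξ : ∀ k i, Measurable (ξ k i)
  law_ξ : ∀ k i, P.map (ξ k i) = gammaMeasure (α + (k i : ℝ)) (A i i)
  indep_ξ : iIndepFun (fun p : (Fin n → ℕ) × Fin n => ξ p.1 p.2) P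
  indep_Z_ξ : IndepFun Z (fun ω (p : (Fin n → ℕ) × Fin n) => ξ p.1 p.2 ω) P

/-- The random vector `X` whose `i`-th component is `ξ k i` on the event `Z = k`. -/
def mixtureVector {n : ℕ} {Ω : Type*} (Z : Ω → Fin n → ℕ)
    (ξ : (Fin n → ℕ) → Fin n → Ω → ℝ) (i : Fin n) (ω : Ω) : ℝ :=
  ξ (Z ω) i ω

/-! ### Cycle counts under relabelling, insertion and deletion of a point. -/

section CycleCount

open Equiv Equiv.Perm

variable {ι ι' : Type*} [Fintype ι] [DecidableEq ι] [Fintype ι'] [DecidableEq ι']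

/-! Given `Z = k`, the components of `X` are independent gamma variables, so splitting over the
values of `Z` turns the Laplace transform into `∑ w(k) ∏ (aᵢ/(aᵢ+sᵢ))^(α+kᵢ)`. Put `C = (D+S)⁻¹B`.
Since row factors pull out of an α-permanent and `A+S = (D+S)(1-C)`, everything reduces to an
α-version of MacMahon's master theorem, `∑ₖ |C(k)|_α / ∏ kᵢ! = |1-C|^(-α)`
(`hasSum_alphaPermanent_repeatedMatrix`). The case `S = 0` gives total mass 1.

Grouped by `k₁+⋯+kₙ = m`, the left side is `∑ cₘ`. Removing points from a cycle gives `(m+1)c_{m+1}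
= α ∑ᵢ tr(C^(i+1)) c_{m-i}` (`succ_mul_alphaCoeff_succ`). Hence `∑ cₘtᵐ` and `|1-tC|^(-α)` solve the
same linear differential equation with value 1 at `t = 0`. To reach `t = 1`, use `v = A⁻¹1`: it is
positive and `Cv < v`, which bounds the entries of `Cᵐ` geometrically and keeps `|1-tC|` positive on
`[0,1]`. -/

theorem numCycles_add_card_support (π : Perm ι) :
    numCycles π + π.support.card = π.cycleType.card + Fintype.card ι := by
  have h : (Finset.univ.filter fun i => π i = i) = π.supportᶜ := by
    ext i; simp
  rw [numCycles, h, add_assoc, Finset.card_compl_add_card]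

/-- By `numCycles_add_card_support` and `sum_cycleType`, the cycle type and the size of the index
set determine `numCycles`; `extendDomain` preserves the cycle type. -/
theorem numCycles_permCongr (e : ι ≃ ι') (π : Perm ι) :
    numCycles (e.permCongr π) = numCycles π := by
  have h : e.permCongr π =
      π.extendDomain (p := fun _ => True) (e.trans (Equiv.subtypeUnivEquiv fun _ => trivial).symm) := by
    ext i
    rw [extendDomain_apply_subtype _ _ trivial]
    simp [Equiv.subtypeUnivEquiv]
  have h1 : (e.permCongr π).cycleType = π.cycleType := by
    rw [h, cycleType_extendDomain]
  have h2 := numCycles_add_card_support (e.permCongr π)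
  have h3 := numCycles_add_card_support π
  rw [← sum_cycleType] at h2 h3
  rw [h1, ← Fintype.card_congr e] at h2
  omega

theorem numCycles_optionCongr (π : Perm ι) :
    numCycles (optionCongr π) = numCycles π + 1 := by
  have h : optionCongr π = π.extendDomain (Equiv.optionIsSomeEquiv ι).symm := by
    ext1 i
    cases i with
    | none => rw [extendDomain_apply_not_subtype _ _ (by simp)]; simp
    | some i =>
      have : (some i : Option ι) = ((Equiv.optionIsSomeEquiv ι).symm i : Option ι) := by simp
      rw [this, extendDomain_apply_image]
      simp
  have h1 : cycleType (optionCongr π : Perm (Option ι)) = π.cycleType := by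
    rw [h, cycleType_extendDomain]
  have h2 := numCycles_add_card_support (optionCongr π)
  have h3 := numCycles_add_card_support π
  rw [← sum_cycleType] at h2 h3
  rw [h1, Fintype.card_option] at h2
  omega

/-- The swap cuts `x` out of its cycle `c` and makes it a fixed point; the remaining factor `d` is
disjoint from `c` and unaffected. -/
theorem numCycles_swap_mul_of_ne {π : Perm ι} {x : ι} (hx : π x ≠ x) :
    numCycles (swap x (π x) * π) = numCycles π + 1 := by
  set c := π.cycleOf x with hc
  have hcx : c x = π x := cycleOf_apply_self π x
  have hcyc : c.IsCycle := isCycle_cycleOf π hx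
  have hmem : c ∈ π.cycleFactorsFinset := cycleOf_mem_cycleFactorsFinset_iff.2 (mem_support.2 hx)
  have hdis : Disjoint c (π * c⁻¹) := (disjoint_mul_inv_of_mem_cycleFactorsFinset hmem).symm
  set d := π * c⁻¹
  have hπ : π = c * d := by
    rw [hdis.commute.eq]; simp [d]
  have h1 : π.cycleType = c.cycleType + d.cycleType := by
    conv_lhs => rw [hπ]
    exact hdis.cycleType_mul
  have hsw : swap x (π x) * π = (swap x (c x) * c) * d := by
    rw [mul_assoc, ← hπ, hcx]
  have hdis' : Disjoint (swap x (c x) * c) d := by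
    rw [disjoint_iff_disjoint_support] at hdis ⊢
    refine hdis.mono_left ((support_mul_le _ _).trans (sup_le ?_ le_rfl))
    rw [support_swap (by rw [hcx]; exact hx.symm)]
    intro y hy
    have hxs : x ∈ c.support := by rw [mem_support, hcx]; exact hx
    rcases Finset.mem_insert.1 hy with rfl | hy
    · exact hxs
    · rw [Finset.mem_singleton.1 hy]; exact apply_mem_support.2 hxs
  have h2 : (swap x (π x) * π).cycleType = (swap x (c x) * c).cycleType + d.cycleType := by
    rw [hsw, hdis'.cycleType_mul]
  have e1 := numCycles_add_card_support π
  have e2 := numCycles_add_card_support (swap x (π x) * π)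
  rw [← sum_cycleType] at e1 e2
  rw [h1] at e1
  rw [h2] at e2
  have hc1 : c.cycleType = {c.support.card} := hcyc.cycleType
  -- A 2-cycle leaves the cycle type altogether and becomes two fixed points; a longer cycle stays a
  -- cycle, one point shorter.
  by_cases hcc : c (c x) = x
  · have hs : c = swap x (c x) := hcyc.eq_swap_of_apply_apply_eq_self (by rwa [hcx]) hcc
    have h3 : swap x (c x) * c = 1 := by
      conv_lhs => rw [hs]
      simp
    have h4 : c.support.card = 2 := by
      rw [hs]; exact card_support_swap (by rw [hcx]; exact hx.symm)
    rw [h3, cycleType_one] at e2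
    rw [hc1, h4] at e1
    simp at e1 e2
    omega
  · have h3 : (swap x (c x) * c).IsCycle := hcyc.swap_mul (by rwa [hcx]) hcc
    have h4 := support_swap_mul_eq c x hcc
    have hxs : x ∈ c.support := by rw [mem_support, hcx]; exact hx
    have h5 : (swap x (c x) * c).support.card + 1 = c.support.card := by
      rw [h4, Finset.sdiff_singleton_eq_erase]
      exact Finset.card_erase_add_one hxs
    rw [h3.cycleType] at e2
    rw [hc1] at e1
    simp at e1 e2
    omega

/-- Here `none` is inserted just before `y` in the cycle of `y`; cutting it out again gives
`optionCongr σ`. -/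
theorem numCycles_swap_mul_optionCongr (y : ι) (σ : Perm ι) :
    numCycles (swap none (some y) * optionCongr σ) = numCycles σ := by
  have h := numCycles_swap_mul_of_ne (π := swap none (some y) * optionCongr σ) (x := none) (by simp)
  have h0 : (swap none (some y) * optionCongr σ) none = some y := by simp
  rw [h0, ← mul_assoc, swap_mul_self, one_mul, numCycles_optionCongr] at h
  omega

end CycleCount

/-! ### Sums over permutations as sums of traces along cycles. -/

section CycleSum

open Equiv Equiv.Perm

variable {ι ι' κ : Type*} [Fintype ι] [DecidableEq ι] [Fintype ι'] [DecidableEq ι'] [Fintype κ]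

theorem alphaPermanent_submatrix (α : ℝ) (e : ι ≃ ι') (M : Matrix ι' ι' ℝ) :
    alphaPermanent α (M.submatrix e e) = alphaPermanent α M := by
  unfold alphaPermanent
  refine Fintype.sum_equiv e.permCongr _ _ fun π => ?_
  rw [numCycles_permCongr]
  congr 1
  refine Fintype.prod_equiv e _ _ fun i => ?_
  simp

theorem alphaPermanent_nonneg {α : ℝ} (hα : 0 ≤ α) {M : Matrix ι ι ℝ} (hM : ∀ i j, 0 ≤ M i j) :
    0 ≤ alphaPermanent α M :=
  Finset.sum_nonneg fun _ _ => mul_nonneg (pow_nonneg hα _) (Finset.prod_nonneg fun _ _ => hM _ _)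

theorem alphaPermanent_of_isEmpty [IsEmpty ι] (α : ℝ) (M : Matrix ι ι ℝ) :
    alphaPermanent α M = 1 := by
  simp [alphaPermanent, numCycles, Subsingleton.elim _ (1 : Perm ι)]

theorem alphaPermanent_mul_left (α : ℝ) (c : ι → ℝ) (M : Matrix ι ι ℝ) :
    alphaPermanent α (Matrix.of fun i j => c i * M i j) = (∏ i, c i) * alphaPermanent α M := by
  simp only [alphaPermanent, Finset.mul_sum, Matrix.of_apply, Finset.prod_mul_distrib]
  exact Finset.sum_congr rfl fun _ _ => by ring

/-- The sum over all permutations `π` of `ι` of `α ^ c(π)` times the product, over the cycles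
`(p₁ p₂ ⋯)` of `π`, of the traces of `C p₁ * C p₂ * ⋯`. -/
noncomputable def cycleTraceSum (α : ℝ) (C : ι → Matrix κ κ ℝ) : ℝ :=
  ∑ i : ι → κ, alphaPermanent α (Matrix.of fun p q => C p (i p) (i q))

theorem cycleTraceSum_comp_equiv (α : ℝ) (e : ι ≃ ι') (C : ι' → Matrix κ κ ℝ) :
    cycleTraceSum α (C ∘ e) = cycleTraceSum α C := by
  unfold cycleTraceSum
  refine Fintype.sum_equiv (e.arrowCongr (Equiv.refl κ)) _ _ fun i => ?_
  rw [← alphaPermanent_submatrix α e]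
  congr 1
  ext p q
  simp

/-- Either `none` is a fixed point, a new cycle worth `α * tr (C none)`, or it directly follows a
unique `p` in a cycle. In the latter case, summing over the index at `none` merges the two factors
into an entry of `C p * C none`. -/
theorem cycleTraceSum_option (α : ℝ) (C : Option ι → Matrix κ κ ℝ) :
    cycleTraceSum α C = α * (C none).trace * cycleTraceSum α (C ∘ some) +
      ∑ p, cycleTraceSum α (Function.update (C ∘ some) p (C (some p) * C none)) := by
  have key : ∀ (i0 : κ) (i : ι → κ),
      alphaPermanent α (Matrix.of fun p q =>
        C p ((Equiv.piOptionEquivProd (β := fun _ => κ)).symm (i0, i) p)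
          ((Equiv.piOptionEquivProd (β := fun _ => κ)).symm (i0, i) q)) =
      α * C none i0 i0 * alphaPermanent α (Matrix.of fun p q => C (some p) (i p) (i q)) +
      ∑ p, ∑ σ : Perm ι, α ^ numCycles σ * ((C (some p) (i p) i0 * C none i0 (i (σ p))) *
        ∏ q ∈ Finset.univ.erase p, C (some q) (i q) (i (σ q))) := by
    intro i0 i
    rw [alphaPermanent, ← Equiv.sum_comp decomposeOption.symm, Fintype.sum_prod_type,
      Fintype.sum_option]
    congr 1
    · rw [alphaPermanent, Finset.mul_sum]
      refine Finset.sum_congr rfl fun σ _ => ?_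
      simp only [decomposeOption_symm_apply, swap_self]
      rw [← Equiv.Perm.one_def, one_mul, numCycles_optionCongr, Fintype.prod_option, pow_succ]
      simp [Equiv.piOptionEquivProd]
      ring
    · rw [Finset.sum_comm, Finset.sum_comm (s := (Finset.univ : Finset ι))]
      refine Finset.sum_congr rfl fun σ _ => ?_
      -- `decomposeOption` records the image `σ p` of `none`; reindexing by `σ` sums over its
      -- predecessor `p` instead.
      rw [← Equiv.sum_comp σ]
      refine Finset.sum_congr rfl fun p _ => ?_
      simp only [decomposeOption_symm_apply]
      rw [numCycles_swap_mul_optionCongr, Fintype.prod_option,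
        ← Finset.mul_prod_erase _ _ (Finset.mem_univ p)]
      have h1 : ∀ q ∈ Finset.univ.erase p,
          (swap none (some (σ p)) * optionCongr σ) (some q) = some (σ q) := by
        intro q hq
        have : σ q ≠ σ p := fun h => (Finset.ne_of_mem_erase hq) (σ.injective h)
        simp [swap_apply_of_ne_of_ne, this]
      rw [Finset.prod_congr rfl fun q hq => by rw [h1 q hq]]
      simp [Equiv.piOptionEquivProd]
      left
      ring
  rw [cycleTraceSum, ← Equiv.sum_comp (Equiv.piOptionEquivProd (β := fun _ => κ)).symm,
    Fintype.sum_prod_type, Finset.sum_congr rfl fun i0 _ => Finset.sum_congr rfl fun i _ => key i0 i]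
  simp only [Finset.sum_add_distrib]
  congr 1
  · simp only [← Finset.mul_sum]
    rw [← Finset.sum_mul, ← Finset.mul_sum]
    rfl
  · rw [Finset.sum_comm]
    simp only [cycleTraceSum]
    rw [Finset.sum_comm (s := (Finset.univ : Finset ι))]
    refine Finset.sum_congr rfl fun i _ => ?_
    rw [Finset.sum_comm]
    refine Finset.sum_congr rfl fun p _ => ?_
    rw [Finset.sum_comm, alphaPermanent]
    refine Finset.sum_congr rfl fun σ _ => ?_
    rw [← Finset.mul_sum, ← Finset.sum_mul, ← Finset.mul_prod_erase _ _ (Finset.mem_univ p)]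
    congr 2
    · simp [Matrix.mul_apply]
    · refine Finset.prod_congr rfl fun q hq => ?_
      simp [Function.update_of_ne (Finset.ne_of_mem_erase hq)]

end CycleSum

/-! ### The recursion for the coefficients. -/

section Recursion

open Equiv Equiv.Perm

variable {κ : Type*} [Fintype κ]

/-- The coefficient of `t ^ m` in `det (1 - t • C) ^ (-α)`, in its expansion over permutations. -/
noncomputable def alphaCoeff (α : ℝ) (C : Matrix κ κ ℝ) (m : ℕ) : ℝ :=
  cycleTraceSum α (fun _ : Fin m => C) / m.factorial

theorem alphaCoeff_zero (α : ℝ) (C : Matrix κ κ ℝ) : alphaCoeff α C 0 = 1 := by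
  simp [alphaCoeff, cycleTraceSum, alphaPermanent_of_isEmpty]

theorem alphaCoeff_nonneg {α : ℝ} (hα : 0 ≤ α) {C : Matrix κ κ ℝ} (hC : ∀ i j, 0 ≤ C i j) (m : ℕ) :
    0 ≤ alphaCoeff α C m :=
  div_nonneg (Finset.sum_nonneg fun _ _ => alphaPermanent_nonneg hα fun _ _ => hC _ _)
    (Nat.cast_nonneg _)

theorem cycleTraceSum_update_fin (α : ℝ) (C E : Matrix κ κ ℝ) (m : ℕ) (p : Fin (m + 1)) :
    cycleTraceSum α (Function.update (fun _ => C) p E) =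
      cycleTraceSum α (fun o : Option (Fin m) => o.elim E fun _ => C) := by
  rw [← cycleTraceSum_comp_equiv α (finSuccEquiv' p)]
  congr 1
  ext1 q
  rcases eq_or_ne q p with rfl | hq
  · simp
  · obtain ⟨r, rfl⟩ := Fin.exists_succAbove_eq hq
    simp [hq]

theorem cycleTraceSum_option_const (α : ℝ) (C E : Matrix κ κ ℝ) (m : ℕ) :
    cycleTraceSum α (fun o : Option (Fin (m + 1)) => o.elim E fun _ => C) =
      α * E.trace * cycleTraceSum α (fun _ : Fin (m + 1) => C) +
        (m + 1) * cycleTraceSum α (fun o : Option (Fin m) => o.elim (C * E) fun _ => C) := by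
  rw [cycleTraceSum_option]
  congr 1
  refine (Finset.sum_congr rfl fun p _ => cycleTraceSum_update_fin α C (C * E) m p).trans ?_
  simp

/-- Follow the cycle through the distinguished point `none`: absorbing one of the other points
raises the exponent `j` by one, which is why `j` is general in the induction. The index `i` counts
the points absorbed before the cycle closes. -/
theorem cycleTraceSum_option_pow [DecidableEq κ] (α : ℝ) (C : Matrix κ κ ℝ) (m : ℕ) : ∀ j : ℕ,
    cycleTraceSum α (fun o : Option (Fin m) => o.elim (C ^ j) fun _ => C) / m.factorial =
      α * ∑ i ∈ Finset.range (m + 1), (C ^ (j + i)).trace * alphaCoeff α C (m - i) := by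
  induction m with
  | zero =>
    intro j
    rw [cycleTraceSum_option]
    simp [alphaCoeff, Function.comp_def, mul_assoc]
  | succ m ih =>
    intro j
    rw [cycleTraceSum_option_const, Finset.sum_range_succ', ← pow_succ']
    have h := ih (j + 1)
    have hm : ((m + 1).factorial : ℝ) = (m + 1) * m.factorial := by
      rw [Nat.factorial_succ]; push_cast; ring
    have h' : ∑ i ∈ Finset.range (m + 1), (C ^ (j + (i + 1))).trace * alphaCoeff α C (m + 1 - (i + 1))
        = ∑ i ∈ Finset.range (m + 1), (C ^ (j + 1 + i)).trace * alphaCoeff α C (m - i) :=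
      Finset.sum_congr rfl fun i _ => by rw [Nat.add_sub_add_right, add_assoc j 1 i, add_comm 1 i]
    rw [h', mul_add, ← h, add_div, add_comm]
    congr 1
    · rw [hm, mul_div_mul_left _ _ (by positivity)]
    · simp only [add_zero, Nat.sub_zero, alphaCoeff]
      ring

/-- The recursion that corresponds to the differential equation
`f' = α * (∑ j, tr (C ^ (j + 1)) * t ^ j) * f` of the generating function. -/
theorem succ_mul_alphaCoeff_succ [DecidableEq κ] (α : ℝ) (C : Matrix κ κ ℝ) (m : ℕ) :
    (m + 1) * alphaCoeff α C (m + 1) =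
      α * ∑ i ∈ Finset.range (m + 1), (C ^ (i + 1)).trace * alphaCoeff α C (m - i) := by
  have h := cycleTraceSum_option_pow α C m 1
  simp only [add_comm 1] at h
  rw [← h, alphaCoeff, ← cycleTraceSum_update_fin α C (C ^ 1) m 0, Nat.factorial_succ, pow_one]
  have h2 : Function.update (fun _ : Fin (m + 1) => C) 0 C = fun _ => C :=
    Function.update_eq_self 0 (fun _ : Fin (m + 1) => C)
  rw [h2]
  push_cast
  have : (m.factorial : ℝ) ≠ 0 := by positivity
  have : (m : ℝ) + 1 ≠ 0 := by positivity
  field_simp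

end Recursion

/-! ### Grouping index sequences by multiplicities. -/

section Multinomial

open Equiv

/-- Orbit counting: permutations of `Fin m` act transitively on the maps with fibre sizes `k`, and
the stabilizer of `i₀` has order `∏ (k j)!`. -/
theorem card_filter_fiber_card_mul_prod_factorial {κ : Type*} [Fintype κ] [DecidableEq κ]
    {m : ℕ} {k : κ → ℕ} (hk : ∑ j, k j = m) :
    (Finset.univ.filter fun i : Fin m → κ => (fun j => Fintype.card {p // i p = j}) = k).card *
      ∏ j, (k j).factorial = m.factorial := by
  classical
  have e : Nonempty (Fin m ≃ (j : κ) × Fin (k j)) := by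
    refine ⟨Fintype.equivOfCardEq ?_⟩
    simp [hk]
  obtain ⟨e⟩ := e
  set i₀ : Fin m → κ := fun p => (e p).1
  have hi₀ : (fun j => Fintype.card {p // i₀ p = j}) = k := by
    ext j
    have e1 : {p // i₀ p = j} ≃ Fin (k j) :=
      (e.subtypeEquiv (q := fun x => x.1 = j) fun p => Iff.rfl).trans (Equiv.sigmaSubtype j)
    rw [Fintype.card_congr e1, Fintype.card_fin]
  have hcard := Finset.card_eq_sum_card_fiberwise (f := fun g : Perm (Fin m) => i₀ ∘ g)
    (s := Finset.univ)
    (t := Finset.univ.filter fun i : Fin m → κ => (fun j => Fintype.card {p // i p = j}) = k)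
    (by
      intro g _
      simp only [Finset.coe_filter, Finset.mem_univ, true_and, Set.mem_ofPred_eq]
      rw [← hi₀]
      ext j
      exact Fintype.card_congr (g.subtypeEquiv fun p => Iff.rfl))
  rw [Finset.card_univ, Fintype.card_perm, Fintype.card_fin] at hcard
  rw [hcard, ← smul_eq_mul, ← Finset.sum_const]
  refine Finset.sum_congr rfl fun i hi => ?_
  have hik : (fun j => Fintype.card {p // i p = j}) = k := (Finset.mem_filter.1 hi).2
  have hg : ∃ g : Perm (Fin m), i₀ ∘ g = i := by
    have hj : ∀ j, Nonempty ({p // i p = j} ≃ {p // i₀ p = j}) := fun j =>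
      ⟨Fintype.equivOfCardEq ((congrFun hik j).trans (congrFun hi₀ j).symm)⟩
    refine ⟨Equiv.ofFiberEquiv fun j => (hj j).some, ?_⟩
    ext1 p
    exact Equiv.ofFiberEquiv_map _ p
  obtain ⟨g, rfl⟩ := hg
  have hs := DomMulAct.stabilizer_card i₀
  rw [Finset.prod_congr rfl fun j _ => by rw [congrFun hi₀ j]] at hs
  rw [← hs, Fintype.card_subtype]
  refine Finset.card_bij' (fun f _ => f * g) (fun f _ => f * g⁻¹) ?_ ?_ ?_ ?_
  · intro f hf
    have := (Finset.mem_filter.1 hf).2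
    simp [Perm.coe_mul, ← Function.comp_assoc, this]
  · intro f hf
    have := (Finset.mem_filter.1 hf).2
    simp only [Finset.mem_filter, Finset.mem_univ, true_and]
    rw [Perm.coe_mul, ← Function.comp_assoc, this, Function.comp_assoc, ← Perm.coe_mul]
    simp
  · intro f _; simp
  · intro f _; simp

theorem alphaPermanent_submatrix_of_fiber_card {n : ℕ} (α : ℝ) (C : Matrix (Fin n) (Fin n) ℝ)
    {m : ℕ} (i : Fin m → Fin n) :
    alphaPermanent α (C.submatrix i i) =
      alphaPermanent α (repeatedMatrix C fun j => Fintype.card {p // i p = j}) := by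
  let e : Fin m ≃ (j : Fin n) × Fin (Fintype.card {p // i p = j}) :=
    (Equiv.sigmaFiberEquiv i).symm.trans (Equiv.sigmaCongrRight fun j => Fintype.equivFin _)
  rw [← alphaPermanent_submatrix α e]
  rfl

theorem alphaCoeff_eq_sum_piAntidiag {n : ℕ} (α : ℝ) (C : Matrix (Fin n) (Fin n) ℝ) (m : ℕ) :
    alphaCoeff α C m = ∑ k ∈ Finset.piAntidiag Finset.univ m,
      alphaPermanent α (repeatedMatrix C k) / ∏ j, ((k j).factorial : ℝ) := by
  rw [alphaCoeff, cycleTraceSum, ← Finset.sum_fiberwise_of_maps_to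
    (g := fun (i : Fin m → Fin n) j => Fintype.card {p // i p = j})
    (t := Finset.piAntidiag Finset.univ m), Finset.sum_div]
  · refine Finset.sum_congr rfl fun k hk => ?_
    have hk' : ∑ j, k j = m := (Finset.mem_piAntidiag.1 hk).1
    have hc := card_filter_fiber_card_mul_prod_factorial hk'
    rw [Finset.sum_congr rfl (g := fun _ => alphaPermanent α (repeatedMatrix C k))]
    · rw [Finset.sum_const, nsmul_eq_mul, ← hc]
      push_cast
      have : (∏ j, ((k j).factorial : ℝ)) ≠ 0 := Finset.prod_ne_zero_iff.2 fun j _ => by positivity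
      have : ((Finset.univ.filter fun i : Fin m → Fin n =>
          (fun j => Fintype.card {p // i p = j}) = k).card : ℝ) ≠ 0 := by
        intro h
        rw [Nat.cast_eq_zero.1 h, zero_mul] at hc
        exact m.factorial_ne_zero hc.symm
      field_simp
    · intro i hi
      rw [← (Finset.mem_filter.1 hi).2]
      exact alphaPermanent_submatrix_of_fiber_card α C i
  · intro i _
    rw [Finset.mem_piAntidiag]
    refine ⟨?_, fun _ _ => Finset.mem_univ _⟩
    rw [← Fintype.card_sigma, Fintype.card_congr (Equiv.sigmaFiberEquiv i), Fintype.card_fin]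

end Multinomial

/-! ### From the recursion to the differential equation. -/

section PowerSeries

open Filter Topology

/-- With `q = r / ρ`, the inductive bound makes the right side at most `K q/(1-q) * M ρ^(m+1)`. The
factor `m + 1` absorbs `K q/(1-q)` once `m + 1 ≥ N`; `M` is chosen to cover the earlier terms. -/
theorem exists_le_mul_pow_of_recursion {a : ℕ → ℝ} (ha : ∀ m, 0 ≤ a m) {K r ρ : ℝ} (hK : 0 ≤ K)
    (hr : 0 ≤ r) (hρ : r < ρ)
    (h : ∀ m : ℕ, (m + 1) * a (m + 1) ≤ ∑ i ∈ Finset.range (m + 1), K * r ^ (i + 1) * a (m - i)) :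
    ∃ M, 0 ≤ M ∧ ∀ m, a m ≤ M * ρ ^ m := by
  have hρ0 : 0 < ρ := hr.trans_lt hρ
  set q := r / ρ with hq
  have hq0 : 0 ≤ q := by positivity
  have hq1 : q < 1 := (div_lt_one hρ0).2 hρ
  have hrq : r = q * ρ := by rw [hq]; field_simp
  obtain ⟨N, hN⟩ := exists_nat_ge (K * (q * (1 - q)⁻¹))
  set M := ∑ l ∈ Finset.range (N + 1), a l / ρ ^ l with hM
  have hM0 : 0 ≤ M := Finset.sum_nonneg fun l _ => div_nonneg (ha l) (by positivity)
  refine ⟨M, hM0, fun m => ?_⟩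
  induction m using Nat.strong_induction_on with
  | _ m ih =>
    rcases le_or_gt m N with hm | hm
    · rw [← div_le_iff₀ (by positivity)]
      exact Finset.single_le_sum (f := fun l => a l / ρ ^ l)
        (fun l _ => div_nonneg (ha l) (by positivity)) (Finset.mem_range.2 (by omega))
    · obtain ⟨m, rfl⟩ : ∃ l, m = l + 1 := ⟨m - 1, by omega⟩
      have h1 : ∑ i ∈ Finset.range (m + 1), K * r ^ (i + 1) * a (m - i) ≤
          ∑ i ∈ Finset.range (m + 1), (K * q * M * ρ ^ (m + 1)) * q ^ i := by
        refine Finset.sum_le_sum fun i hi => ?_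
        have hi' : i ≤ m := Nat.lt_succ_iff.1 (Finset.mem_range.1 hi)
        calc K * r ^ (i + 1) * a (m - i) ≤ K * r ^ (i + 1) * (M * ρ ^ (m - i)) := by
              gcongr
              exact ih _ (by omega)
          _ = (K * q * M * ρ ^ (m + 1)) * q ^ i := by
              have : ρ ^ (m + 1) = ρ ^ (i + 1) * ρ ^ (m - i) := by
                rw [← pow_add]; congr 1; omega
              rw [hrq, this, mul_pow, pow_succ q]
              ring
      have h2 : ∑ i ∈ Finset.range (m + 1), q ^ i ≤ (1 - q)⁻¹ := by
        rw [← tsum_geometric_of_lt_one hq0 hq1]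
        exact (summable_geometric_of_lt_one hq0 hq1).sum_le_tsum _ fun i _ => by positivity
      have hm1 : (N : ℝ) ≤ (m : ℝ) + 1 := by exact_mod_cast hm.le
      have hmp : (0 : ℝ) < (m : ℝ) + 1 := by positivity
      refine le_of_mul_le_mul_left ?_ hmp
      calc ((m : ℝ) + 1) * a (m + 1)
          ≤ ∑ i ∈ Finset.range (m + 1), (K * q * M * ρ ^ (m + 1)) * q ^ i := (h m).trans h1
        _ = (K * q * M * ρ ^ (m + 1)) * ∑ i ∈ Finset.range (m + 1), q ^ i :=
            (Finset.mul_sum _ _ _).symm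
        _ ≤ (K * q * M * ρ ^ (m + 1)) * (1 - q)⁻¹ := by gcongr
        _ = (K * (q * (1 - q)⁻¹)) * (M * ρ ^ (m + 1)) := by ring
        _ ≤ (m + 1) * (M * ρ ^ (m + 1)) := by
            gcongr
            exact hN.trans hm1

theorem summable_mul_pow_of_le_geometric {a : ℕ → ℝ} (ha : ∀ m, 0 ≤ a m) {M ρ : ℝ} (hρ : 0 ≤ ρ)
    (hρ1 : ρ < 1) (hM : ∀ m, a m ≤ M * ρ ^ m) {t : ℝ} (ht : t ∈ Set.Icc (0 : ℝ) 1) :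
    Summable fun m => a m * t ^ m :=
  Summable.of_nonneg_of_le (fun m => mul_nonneg (ha m) (pow_nonneg ht.1 m))
    (fun m => (mul_le_of_le_one_right (ha m) (pow_le_one₀ ht.1 ht.2)).trans (hM m))
    ((summable_geometric_of_lt_one hρ hρ1).mul_left M)

theorem hasDerivAt_tsum_mul_pow_of_le_geometric {a : ℕ → ℝ} (ha : ∀ m, 0 ≤ a m) {M ρ : ℝ}
    (hM0 : 0 ≤ M) (hρ : 0 < ρ) (hρ1 : ρ < 1) (hM : ∀ m, a m ≤ M * ρ ^ m) {t : ℝ}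
    (ht : t ∈ Set.Icc (0 : ℝ) 1) :
    HasDerivAt (fun y => ∑' m, a m * y ^ m) (∑' m : ℕ, ((m + 1) * a (m + 1)) * t ^ m) t := by
  -- A radius beyond 1 makes `t = 1` an interior point, so the derivative there is two-sided.
  obtain ⟨R, hR1, hR⟩ : ∃ R, 1 < R ∧ R < ρ⁻¹ := exists_between ((one_lt_inv₀ hρ).2 hρ1)
  have hR0 : 0 < R := by linarith
  have hρR : ρ * R < 1 := by rwa [← lt_inv_mul_iff₀ hρ, mul_one]
  have hnorm : ‖ρ * R‖ < 1 := by rwa [Real.norm_of_nonneg (mul_pos hρ hR0).le]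
  have hu : Summable fun m : ℕ => M * R⁻¹ * ((m : ℝ) ^ 1 * (ρ * R) ^ m) :=
    (summable_pow_mul_geometric_of_norm_lt_one 1 hnorm).mul_left (M * R⁻¹)
  have hbound : ∀ (m : ℕ) (y : ℝ), ‖y‖ ≤ R →
      ‖a m * (m * y ^ (m - 1))‖ ≤ M * R⁻¹ * ((m : ℝ) ^ 1 * (ρ * R) ^ m) := by
    intro m y hy
    rw [norm_mul, norm_mul, norm_pow, Real.norm_of_nonneg (ha m), Real.norm_natCast]
    rcases m with _ | m
    · simp
    · calc a (m + 1) * (((m + 1 : ℕ) : ℝ) * ‖y‖ ^ m)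
          ≤ (M * ρ ^ (m + 1)) * (((m + 1 : ℕ) : ℝ) * R ^ m) := by
            gcongr
            exact hM _
        _ = M * R⁻¹ * (((m + 1 : ℕ) : ℝ) ^ 1 * (ρ * R) ^ (m + 1)) := by
            rw [mul_pow, pow_one, pow_succ R]
            field_simp
  have hmem : ∀ t ∈ Set.Icc (0 : ℝ) 1, t ∈ Metric.ball (0 : ℝ) R := by
    intro t ht
    rw [Metric.mem_ball, dist_zero_right, Real.norm_of_nonneg ht.1]
    exact ht.2.trans_lt hR1
  have hder := hasDerivAt_tsum_of_isPreconnected (g := fun m y => a m * y ^ m)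
    (g' := fun m y => a m * (m * y ^ (m - 1))) hu Metric.isOpen_ball
    (convex_ball (0 : ℝ) R).isPreconnected (fun m y _ => (hasDerivAt_pow m y).const_mul (a m))
    (fun m y hy => hbound m y (by rw [← dist_zero_right]; exact (Metric.mem_ball.1 hy).le))
    (hmem 0 (by simp)) (summable_mul_pow_of_le_geometric ha hρ.le hρ1 hM (by simp)) (hmem t ht)
  have hs : Summable fun m : ℕ => a m * (m * t ^ (m - 1)) :=
    Summable.of_norm_bounded hu fun m => hbound m t
      (by rw [Real.norm_of_nonneg ht.1]; exact ht.2.trans hR1.le)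
  refine hder.congr_deriv ?_
  rw [hs.tsum_eq_zero_add, Nat.cast_zero, zero_mul, mul_zero, zero_add]
  refine tsum_congr fun m => ?_
  rw [Nat.add_sub_cancel]
  push_cast
  ring

/-- By the Cauchy product, the recursion says `f' = L f` for `f(t) = ∑ aₘtᵐ`, while `F' = -L F`; so
`f F` is constant on `[0,1]`. -/
theorem hasSum_of_recursion_of_hasDerivAt {a p : ℕ → ℝ} (ha : ∀ m, 0 ≤ a m) (ha0 : a 0 = 1)
    {K r : ℝ} (hK : 0 ≤ K) (hr : 0 ≤ r) (hr1 : r < 1)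
    (hpr : ∀ i, p i ≤ K * r ^ (i + 1))
    (h : ∀ m : ℕ, (m + 1) * a (m + 1) = ∑ i ∈ Finset.range (m + 1), p i * a (m - i))
    {F L : ℝ → ℝ} (hF0 : F 0 = 1)
    (hL : ∀ t ∈ Set.Icc (0 : ℝ) 1, HasSum (fun i => p i * t ^ i) (L t))
    (hF : ∀ t ∈ Set.Icc (0 : ℝ) 1, HasDerivAt F (-(L t * F t)) t) :
    HasSum a (F 1)⁻¹ := by
  obtain ⟨ρ, hrρ, hρ1⟩ := exists_between hr1
  have hρ0 : 0 < ρ := hr.trans_lt hrρ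
  obtain ⟨M, hM0, hM⟩ := exists_le_mul_pow_of_recursion ha hK hr hrρ fun m => by
    rw [h m]
    exact Finset.sum_le_sum fun i _ => mul_le_mul_of_nonneg_right (hpr i) (ha _)
  have hsum : ∀ t ∈ Set.Icc (0 : ℝ) 1, Summable fun m => a m * t ^ m := fun t ht =>
    summable_mul_pow_of_le_geometric ha hρ0.le hρ1 hM ht
  have hder : ∀ t ∈ Set.Icc (0 : ℝ) 1,
      HasDerivAt (fun y => ∑' m, a m * y ^ m) (L t * ∑' m, a m * t ^ m) t := by
    intro t ht
    convert hasDerivAt_tsum_mul_pow_of_le_geometric ha hM0 hρ0 hρ1 hM ht using 1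
    rw [← (hL t ht).tsum_eq,
      tsum_mul_tsum_eq_tsum_sum_range_of_summable_norm (hL t ht).summable.norm (hsum t ht).norm]
    refine tsum_congr fun m => ?_
    rw [h m, Finset.sum_mul]
    refine Finset.sum_congr rfl fun i hi => ?_
    have hi' : i ≤ m := Nat.lt_succ_iff.1 (Finset.mem_range.1 hi)
    obtain ⟨l, rfl⟩ := Nat.exists_eq_add_of_le hi'
    rw [Nat.add_sub_cancel_left, pow_add]
    ring
  have hprod : ∀ t ∈ Set.Icc (0 : ℝ) 1,
      HasDerivAt (fun y => (∑' m, a m * y ^ m) * F y) 0 t := by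
    intro t ht
    exact ((hder t ht).fun_mul (hF t ht)).congr_deriv (by ring)
  have hconst := constant_of_has_deriv_right_zero
    (fun t ht => (hprod t ht).continuousAt.continuousWithinAt)
    (fun t ht => (hprod t (Set.Ico_subset_Icc_self ht)).hasDerivWithinAt) 1 (by simp)
  have h0 : ∑' m, a m * (0 : ℝ) ^ m = 1 := by
    rw [tsum_eq_single 0 (fun m hm => by simp [hm])]
    simp [ha0]
  simp only [h0, hF0, mul_one, one_pow] at hconst
  have hs1 := (hsum 1 (by simp)).hasSum
  simp only [one_pow, mul_one] at hs1
  rwa [eq_inv_of_mul_eq_one_left hconst] at hs1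

end PowerSeries

/-! ### Determinants, traces of powers and the master theorem. -/

section Determinant

open Filter Topology

variable {κ : Type*} [Fintype κ] [DecidableEq κ]

/-- Factor `1 - yC = (1 - tC)(1 - (y-t)E)` and expand the second determinant to first order in `y -
t`; `P` carries the remainder. -/
theorem hasDerivAt_det_one_sub_smul (C : Matrix κ κ ℝ) {t : ℝ}
    (ht : (1 - t • C).det ≠ 0) :
    HasDerivAt (fun y : ℝ => (1 - y • C).det)
      (-(((1 - t • C)⁻¹ * C).trace * (1 - t • C).det)) t := by
  set E := (1 - t • C)⁻¹ * C with hE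
  have hmul : (1 - t • C) * E = C := by
    rw [hE, Matrix.mul_nonsing_inv_cancel_left _ _ (isUnit_iff_ne_zero.2 ht)]
  set P := (Matrix.det (1 + (Polynomial.X : Polynomial ℝ) • (-E).map Polynomial.C)).divX.divX
  have hfun : (fun y : ℝ => (1 - y • C).det) = fun y : ℝ =>
      (1 - t • C).det * (1 + (-E).trace * (y - t) + P.eval (y - t) * (y - t) ^ 2) := by
    ext y
    rw [← Matrix.det_one_add_smul, ← Matrix.det_mul]
    congr 1
    rw [mul_add, mul_one, Matrix.mul_smul, Matrix.mul_neg, hmul, smul_neg, sub_smul]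
    abel
  rw [hfun]
  have h1 : HasDerivAt (fun y : ℝ => y - t) 1 t := (hasDerivAt_id t).sub_const t
  have h2 : HasDerivAt (fun y : ℝ => P.eval (y - t)) (P.derivative.eval (t - t) * 1) t :=
    HasDerivAt.comp (h₂ := fun z => P.eval z) (h := fun y => y - t) t (P.hasDerivAt (t - t)) h1
  have h3 := (((h1.const_mul (-E).trace).const_add 1).fun_add (h2.fun_mul (h1.fun_pow 2))).const_mul
    (1 - t • C).det
  refine h3.congr_deriv ?_
  rw [sub_self, Matrix.trace_neg]
  ring

/-- Iteration gives `Cᵐv ≤ rᵐv`, and one term of the sum `(Cᵐv)ᵢ` is at most the whole. -/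
theorem pow_apply_le_of_mulVec_le {C : Matrix κ κ ℝ} (hC : ∀ i j, 0 ≤ C i j) {v : κ → ℝ}
    (hv : ∀ i, 0 < v i) {r : ℝ} (hr : 0 ≤ r) (hCv : ∀ i, (C.mulVec v) i ≤ r * v i) (m : ℕ) :
    (∀ i j, 0 ≤ (C ^ m) i j) ∧ ∀ i j, (C ^ m) i j ≤ v i / v j * r ^ m := by
  have h0 : ∀ m, ∀ i j, 0 ≤ (C ^ m) i j := by
    intro m
    induction m with
    | zero => intro i j; rw [pow_zero, Matrix.one_apply]; split_ifs <;> norm_num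
    | succ m ih =>
      intro i j
      rw [pow_succ, Matrix.mul_apply]
      exact Finset.sum_nonneg fun l _ => mul_nonneg (ih i l) (hC l j)
  have h1 : ∀ m, ∀ i, ((C ^ m).mulVec v) i ≤ r ^ m * v i := by
    intro m
    induction m with
    | zero => intro i; simp
    | succ m ih =>
      intro i
      rw [pow_succ, ← Matrix.mulVec_mulVec]
      calc ((C ^ m).mulVec (C.mulVec v)) i ≤ ((C ^ m).mulVec (r • v)) i :=
            Finset.sum_le_sum fun l _ => mul_le_mul_of_nonneg_left (hCv l) (h0 m i l)
        _ = r * ((C ^ m).mulVec v) i := by rw [Matrix.mulVec_smul]; rfl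
        _ ≤ r * (r ^ m * v i) := mul_le_mul_of_nonneg_left (ih i) hr
        _ = r ^ (m + 1) * v i := by ring
  refine ⟨h0 m, fun i j => ?_⟩
  rw [div_mul_eq_mul_div, le_div_iff₀ (hv j), mul_comm (v i)]
  exact (Finset.single_le_sum (f := fun l => (C ^ m) i l * v l)
    (fun l _ => mul_nonneg (h0 m i l) (hv l).le) (Finset.mem_univ j)).trans (h1 m i)

theorem hasSum_trace_pow_of_mulVec_le {C : Matrix κ κ ℝ} (hC : ∀ i j, 0 ≤ C i j) {v : κ → ℝ}
    (hv : ∀ i, 0 < v i) {r : ℝ} (hr : 0 ≤ r) (hr1 : r < 1)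
    (hCv : ∀ i, (C.mulVec v) i ≤ r * v i) {t : ℝ} (ht : t ∈ Set.Icc (0 : ℝ) 1)
    (hdet : (1 - t • C).det ≠ 0) :
    HasSum (fun i => (C ^ (i + 1)).trace * t ^ i) ((1 - t • C)⁻¹ * C).trace := by
  set E := (1 - t • C)⁻¹
  have hpow := pow_apply_le_of_mulVec_le hC hv hr hCv
  have hE : E * (1 - t • C) = 1 := Matrix.nonsing_inv_mul _ (isUnit_iff_ne_zero.2 hdet)
  have hpart : ∀ N : ℕ, ∑ i ∈ Finset.range N, (C ^ (i + 1)).trace * t ^ i =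
      (E * C).trace - ∑ i, ∑ j, E i j * (t ^ N * (C ^ (N + 1)) j i) := by
    intro N
    have h1 : (∑ i ∈ Finset.range N, (t • C) ^ i) * C = E * C - E * (t ^ N • C ^ (N + 1)) := by
      rw [← one_mul (∑ i ∈ Finset.range N, (t • C) ^ i), ← hE, mul_assoc E, mul_neg_geom_sum,
        smul_pow, mul_assoc, sub_mul, one_mul, mul_sub, Matrix.smul_mul, ← pow_succ]
    have h2 := congrArg Matrix.trace h1
    rw [Finset.sum_mul, Matrix.trace_sum, Matrix.trace_sub] at h2
    rw [Finset.sum_congr rfl (g := fun i => ((t • C) ^ i * C).trace), h2]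
    · simp only [Matrix.trace, Matrix.diag, Matrix.mul_apply, Matrix.smul_apply, smul_eq_mul]
    · intro i _
      rw [smul_pow, Matrix.smul_mul, ← pow_succ, Matrix.trace_smul, smul_eq_mul, mul_comm]
  have htr : ∀ m, 0 ≤ (C ^ m).trace := fun m => Finset.sum_nonneg fun i _ => (hpow m).1 i i
  rw [hasSum_iff_tendsto_nat_of_nonneg fun i => mul_nonneg (htr _) (pow_nonneg ht.1 i)]
  simp only [hpart]
  have hz : Tendsto (fun N : ℕ => ∑ i, ∑ j, E i j * (t ^ N * (C ^ (N + 1)) j i)) atTop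
      (𝓝 (∑ i : κ, ∑ j : κ, E i j * 0)) := by
    refine tendsto_finsetSum _ fun i _ => tendsto_finsetSum _ fun j _ => Tendsto.const_mul _ ?_
    have hlim : Tendsto (fun N : ℕ => v j / v i * r ^ (N + 1)) atTop (𝓝 (v j / v i * 0)) :=
      ((tendsto_pow_atTop_nhds_zero_of_lt_one hr hr1).comp (tendsto_add_atTop_nat 1)).const_mul _
    rw [mul_zero] at hlim
    refine squeeze_zero (fun N => mul_nonneg (pow_nonneg ht.1 N) ((hpow _).1 j i)) (fun N => ?_) hlim
    calc t ^ N * (C ^ (N + 1)) j i ≤ 1 * (C ^ (N + 1)) j i :=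
          mul_le_mul_of_nonneg_right (pow_le_one₀ ht.1 ht.2) ((hpow _).1 j i)
      _ ≤ _ := by rw [one_mul]; exact (hpow _).2 j i
  simp only [mul_zero, Finset.sum_const_zero] at hz
  simpa using hz.const_sub (E * C).trace

/-- Scaling the columns by `v` makes `A` strictly diagonally dominant. -/
theorem det_ne_zero_of_mulVec_pos {A : Matrix κ κ ℝ} (hA : ∀ i j, i ≠ j → A i j ≤ 0)
    {v : κ → ℝ} (hv : ∀ i, 0 < v i) (hAv : ∀ i, 0 < (A.mulVec v) i) : A.det ≠ 0 := by
  have h : (A * Matrix.diagonal v).det ≠ 0 := by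
    refine det_ne_zero_of_sum_row_lt_diag fun i => ?_
    simp only [Matrix.mul_diagonal]
    have h1 : (A.mulVec v) i = A i i * v i + ∑ j ∈ Finset.univ.erase i, A i j * v j :=
      (Finset.add_sum_erase _ _ (Finset.mem_univ i)).symm
    have h2 : ∑ j ∈ Finset.univ.erase i, ‖A i j * v j‖ =
        -∑ j ∈ Finset.univ.erase i, A i j * v j := by
      rw [← Finset.sum_neg_distrib]
      refine Finset.sum_congr rfl fun j hj => ?_
      rw [Real.norm_of_nonpos]
      exact mul_nonpos_of_nonpos_of_nonneg (hA i j (Finset.ne_of_mem_erase hj).symm) (hv j).le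
    have h3 := hAv i
    rw [h2]
    exact lt_of_lt_of_le (by linarith) (le_abs_self _)
  rw [Matrix.det_mul] at h
  exact left_ne_zero_of_mul h

/-- The determinant is 1 at `t = 0` and never vanishes on `[0,1]`, so it cannot change sign. -/
theorem det_one_sub_smul_pos {C : Matrix κ κ ℝ} (hC : ∀ i j, 0 ≤ C i j) {v : κ → ℝ}
    (hv : ∀ i, 0 < v i) (hCv : ∀ i, (C.mulVec v) i < v i) {t : ℝ} (ht : t ∈ Set.Icc (0 : ℝ) 1) :
    0 < (1 - t • C).det := by
  have hne : ∀ s ∈ Set.Icc (0 : ℝ) 1, (1 - s • C).det ≠ 0 := by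
    intro s hs
    refine det_ne_zero_of_mulVec_pos (fun i j hij => ?_) hv fun i => ?_
    · simp only [Matrix.sub_apply, Matrix.one_apply_ne hij, Matrix.smul_apply, smul_eq_mul, zero_sub]
      exact neg_nonpos.2 (mul_nonneg hs.1 (hC i j))
    · rw [Matrix.sub_mulVec, Matrix.one_mulVec, Matrix.smul_mulVec]
      simp only [Pi.sub_apply, Pi.smul_apply, smul_eq_mul, sub_pos]
      have h0 : 0 ≤ (C.mulVec v) i := Finset.sum_nonneg fun j _ => mul_nonneg (hC i j) (hv j).le
      exact (mul_le_of_le_one_left h0 hs.2).trans_lt (hCv i)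
  have hcont : Continuous fun s : ℝ => (1 - s • C).det := by fun_prop
  by_contra! hneg
  obtain ⟨s, hs, h0⟩ := intermediate_value_Icc' ht.1 hcont.continuousOn
    (show (0 : ℝ) ∈ Set.Icc _ _ from ⟨hneg, by simp⟩)
  exact hne s ⟨hs.1, hs.2.trans ht.2⟩ h0

/-- The generating function of the coefficients `alphaCoeff α C`, evaluated at `1`. -/
theorem hasSum_alphaCoeff {α : ℝ} (hα : 0 ≤ α) {C : Matrix κ κ ℝ} (hC : ∀ i j, 0 ≤ C i j)
    {v : κ → ℝ} (hv : ∀ i, 0 < v i) (hCv : ∀ i, (C.mulVec v) i < v i) :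
    HasSum (alphaCoeff α C) ((1 - C).det ^ α)⁻¹ := by
  -- Finitely many strict inequalities survive for `r` slightly below 1.
  obtain ⟨r, hCr, hr, hr1⟩ : ∃ r : ℝ, (∀ i, (C.mulVec v) i ≤ r * v i) ∧ 0 ≤ r ∧ r < 1 := by
    have h1 : ∀ᶠ r in 𝓝[<] (1 : ℝ), ∀ i, (C.mulVec v) i ≤ r * v i := by
      rw [eventually_all]
      intro i
      have : Tendsto (fun r : ℝ => r * v i) (𝓝[<] 1) (𝓝 (1 * v i)) :=
        (tendsto_id.mul_const (v i)).mono_left nhdsWithin_le_nhds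
      rw [one_mul] at this
      exact this.eventually_const_le (hCv i)
    have h2 : ∀ᶠ r in 𝓝[<] (1 : ℝ), 0 ≤ r :=
      nhdsWithin_le_nhds (eventually_ge_nhds zero_lt_one)
    exact (h1.and (h2.and self_mem_nhdsWithin)).exists
  have hpos : ∀ t ∈ Set.Icc (0 : ℝ) 1, 0 < (1 - t • C).det := fun t ht =>
    det_one_sub_smul_pos hC hv hCv ht
  have hpow := pow_apply_le_of_mulVec_le hC hv hr hCr
  have htr : ∀ m, 0 ≤ (C ^ m).trace := fun m => Finset.sum_nonneg fun i _ => (hpow m).1 i i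
  have key := hasSum_of_recursion_of_hasDerivAt (a := alphaCoeff α C)
    (p := fun i => α * (C ^ (i + 1)).trace) (K := α * Fintype.card κ) (r := r)
    (F := fun t => (1 - t • C).det ^ α) (L := fun t => α * ((1 - t • C)⁻¹ * C).trace)
    (alphaCoeff_nonneg hα hC) (alphaCoeff_zero α C)
    (by positivity) hr hr1 ?_ ?_ (by simp) ?_ ?_
  · simpa using key
  · intro i
    rw [mul_assoc]
    refine mul_le_mul_of_nonneg_left ?_ hα
    rw [← nsmul_eq_mul, ← Finset.card_univ, ← Finset.sum_const]
    refine Finset.sum_le_sum fun j _ => ((hpow (i + 1)).2 j j).trans_eq ?_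
    rw [div_self (hv j).ne', one_mul]
  · intro m
    rw [succ_mul_alphaCoeff_succ, Finset.mul_sum]
    exact Finset.sum_congr rfl fun i _ => by ring
  · intro t ht
    simp only [mul_assoc]
    exact (hasSum_trace_pow_of_mulVec_le hC hv hr hr1 hCr ht (hpos t ht).ne').mul_left α
  · intro t ht
    have h := (hasDerivAt_det_one_sub_smul C (hpos t ht).ne').rpow_const (p := α)
      (Or.inl (hpos t ht).ne')
    convert h using 1
    have h2 : (1 - t • C).det ^ α = (1 - t • C).det ^ (α - 1) * (1 - t • C).det := by
      rw [← Real.rpow_add_one (hpos t ht).ne', sub_add_cancel]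
    rw [h2]
    ring

/-- The `α`-permanent version of MacMahon's master theorem, for nonnegative matrices. -/
theorem hasSum_alphaPermanent_repeatedMatrix {n : ℕ} {α : ℝ} (hα : 0 ≤ α)
    {C : Matrix (Fin n) (Fin n) ℝ} (hC : ∀ i j, 0 ≤ C i j)
    {v : Fin n → ℝ} (hv : ∀ i, 0 < v i) (hCv : ∀ i, (C.mulVec v) i < v i) :
    HasSum (fun k : Fin n → ℕ => alphaPermanent α (repeatedMatrix C k) /
      ∏ j, ((k j).factorial : ℝ)) ((1 - C).det ^ α)⁻¹ := by
  set f : (Fin n → ℕ) → ℝ := fun k => alphaPermanent α (repeatedMatrix C k) /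
      ∏ j, ((k j).factorial : ℝ)
  have hf : ∀ k, 0 ≤ f k := fun k =>
    div_nonneg (alphaPermanent_nonneg hα fun _ _ => hC _ _) (by positivity)
  have h := hasSum_alphaCoeff hα hC hv hCv
  let e := Equiv.sigmaFiberEquiv fun k : Fin n → ℕ => ∑ j, k j
  have hfib : ∀ m, HasSum (fun k : {k : Fin n → ℕ // ∑ j, k j = m} => f k) (alphaCoeff α C m) := by
    intro m
    rw [alphaCoeff_eq_sum_piAntidiag]
    have hset : {k : Fin n → ℕ | ∑ j, k j = m} = ↑(Finset.piAntidiag (Finset.univ : Finset (Fin n)) m) := by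
      ext k; simp
    have := (Finset.piAntidiag (Finset.univ : Finset (Fin n)) m).hasSum f
    have h2 : HasSum (f ∘ (↑) : {k : Fin n → ℕ | ∑ j, k j = m} → ℝ)
        (∑ k ∈ Finset.piAntidiag Finset.univ m, f k) := by
      rw [hset]; exact this
    exact h2
  rw [← e.hasSum_iff]
  -- Nonnegative terms allow summability to be checked degree by degree.
  have hsum : Summable (f ∘ e) := by
    refine (summable_sigma_of_nonneg (f := f ∘ e) fun x => hf _).2
       ⟨fun m => (hfib m).summable, ?_⟩
    have : (fun m => ∑' k, (f ∘ e) ⟨m, k⟩) = alphaCoeff α C := funext fun m => (hfib m).tsum_eq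
    rw [this]
    exact h.summable
  have h3 := hsum.hasSum.sigma hfib
  rw [← h3.unique h]
  exact hsum.hasSum

end Determinant

/-! ### M-matrices and the mixture weights. -/

section MMatrix

variable {n : ℕ} {A : Matrix (Fin n) (Fin n) ℝ}

theorem offDiagPart_nonneg (hA : IsNonsingularMMatrix A) (i j : Fin n) : 0 ≤ offDiagPart A i j := by
  rcases eq_or_ne i j with rfl | hij
  · simp [offDiagPart]
  · simpa [offDiagPart, hij] using hA.offDiag_nonpos i j hij

theorem IsNonsingularMMatrix.mul_inv (hA : IsNonsingularMMatrix A) : A * A⁻¹ = 1 :=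
  Matrix.mul_nonsing_inv A hA.nonsingular

theorem IsNonsingularMMatrix.diag_pos (hA : IsNonsingularMMatrix A) (i : Fin n) : 0 < A i i := by
  have h : (A * A⁻¹) i i = 1 := by rw [hA.mul_inv, Matrix.one_apply_eq]
  rw [Matrix.mul_apply, ← Finset.add_sum_erase _ _ (Finset.mem_univ i)] at h
  have h2 : ∑ j ∈ Finset.univ.erase i, A i j * A⁻¹ j i ≤ 0 := Finset.sum_nonpos fun j hj =>
    mul_nonpos_of_nonpos_of_nonneg (hA.offDiag_nonpos i j (Finset.ne_of_mem_erase hj).symm)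
      (hA.inv_nonneg j i)
  exact pos_of_mul_pos_left (b := A⁻¹ i i) (by linarith) (hA.inv_nonneg i i)

/-- The vector `v = A⁻¹1` is nonnegative, and the off-diagonal terms of `(Av)ᵢ = 1` are nonpositive,
so `aᵢvᵢ ≥ 1`. -/
theorem IsNonsingularMMatrix.exists_mulVec_eq_one (hA : IsNonsingularMMatrix A) :
    ∃ v : Fin n → ℝ, (∀ i, 0 < v i) ∧ A.mulVec v = 1 := by
  have hv : A.mulVec (A⁻¹.mulVec 1) = 1 := by
    rw [Matrix.mulVec_mulVec, hA.mul_inv, Matrix.one_mulVec]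
  have h0 : ∀ i, 0 ≤ (A⁻¹.mulVec 1) i := fun i =>
    Finset.sum_nonneg (s := Finset.univ) (f := fun j => A⁻¹ i j * (1 : Fin n → ℝ) j)
      fun j _ => mul_nonneg (hA.inv_nonneg i j) zero_le_one
  refine ⟨A⁻¹.mulVec 1, fun i => ?_, hv⟩
  have h : (A.mulVec (A⁻¹.mulVec 1)) i = 1 := congrFun hv i
  rw [Matrix.mulVec, dotProduct, ← Finset.add_sum_erase _ _ (Finset.mem_univ i)] at h
  have h2 : ∑ j ∈ Finset.univ.erase i, A i j * (A⁻¹.mulVec 1) j ≤ 0 := Finset.sum_nonpos fun j hj =>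
    mul_nonpos_of_nonpos_of_nonneg (hA.offDiag_nonpos i j (Finset.ne_of_mem_erase hj).symm) (h0 j)
  exact pos_of_mul_pos_right (a := A i i) (by linarith) (hA.diag_pos i).le

/-- The matrix `(D + S)⁻¹ * B`, where `A = D - B` and `S` is the diagonal matrix of `s`. -/
noncomputable def scaledOffDiagPart (A : Matrix (Fin n) (Fin n) ℝ) (s : Fin n → ℝ) :
    Matrix (Fin n) (Fin n) ℝ :=
  Matrix.diagonal (fun i => (A i i + s i)⁻¹) * offDiagPart A

variable {s : Fin n → ℝ}

theorem diag_add_pos (hA : IsNonsingularMMatrix A) (hs : ∀ i, 0 ≤ s i) (i : Fin n) :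
    0 < A i i + s i :=
  add_pos_of_pos_of_nonneg (hA.diag_pos i) (hs i)

theorem scaledOffDiagPart_nonneg (hA : IsNonsingularMMatrix A) (hs : ∀ i, 0 ≤ s i) (i j : Fin n) :
    0 ≤ scaledOffDiagPart A s i j := by
  rw [scaledOffDiagPart, Matrix.diagonal_mul]
  exact mul_nonneg (inv_nonneg.2 (diag_add_pos hA hs i).le) (offDiagPart_nonneg hA i j)

/-- From `Av = 1` follows `(Bv)ᵢ = aᵢvᵢ - 1 < (aᵢ+sᵢ)vᵢ`. -/
theorem exists_scaledOffDiagPart_mulVec_lt (hA : IsNonsingularMMatrix A) (hs : ∀ i, 0 ≤ s i) :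
    ∃ v : Fin n → ℝ, (∀ i, 0 < v i) ∧ ∀ i, ((scaledOffDiagPart A s).mulVec v) i < v i := by
  obtain ⟨v, hv, hAv⟩ := hA.exists_mulVec_eq_one
  refine ⟨v, hv, fun i => ?_⟩
  rw [scaledOffDiagPart, ← Matrix.mulVec_mulVec, Matrix.mulVec_diagonal, offDiagPart,
    Matrix.sub_mulVec, hAv, Pi.sub_apply, Matrix.mulVec_diagonal,
    inv_mul_lt_iff₀ (diag_add_pos hA hs i), Pi.one_apply]
  nlinarith [mul_nonneg (hs i) (hv i).le]

theorem one_sub_scaledOffDiagPart (hA : IsNonsingularMMatrix A) (hs : ∀ i, 0 ≤ s i) :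
    1 - scaledOffDiagPart A s =
      Matrix.diagonal (fun i => (A i i + s i)⁻¹) * (A + Matrix.diagonal s) := by
  ext i j
  have := (diag_add_pos hA hs i).ne'
  rw [Matrix.sub_apply, scaledOffDiagPart, Matrix.diagonal_mul, Matrix.diagonal_mul]
  rcases eq_or_ne i j with rfl | hij
  · simp [offDiagPart, this]
  · simp [offDiagPart, hij]

theorem det_add_diagonal_pos (hA : IsNonsingularMMatrix A) (hs : ∀ i, 0 ≤ s i) :
    0 < (A + Matrix.diagonal s).det := by
  obtain ⟨v, hv, hCv⟩ := exists_scaledOffDiagPart_mulVec_lt hA hs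
  have h := det_one_sub_smul_pos (scaledOffDiagPart_nonneg hA hs) hv hCv (t := 1) (by simp)
  rw [one_smul, one_sub_scaledOffDiagPart hA hs, Matrix.det_mul, Matrix.det_diagonal] at h
  exact pos_of_mul_pos_right h
    (Finset.prod_nonneg fun i _ => inv_nonneg.2 (diag_add_pos hA hs i).le)

theorem alphaPermanent_repeatedMatrix_diagonal_mul (α : ℝ) (c : Fin n → ℝ)
    (C : Matrix (Fin n) (Fin n) ℝ) (k : Fin n → ℕ) :
    alphaPermanent α (repeatedMatrix (Matrix.diagonal c * C) k) =
      (∏ i, c i ^ k i) * alphaPermanent α (repeatedMatrix C k) := by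
  have h : repeatedMatrix (Matrix.diagonal c * C) k =
      Matrix.of fun p q => c p.1 * repeatedMatrix C k p q := by
    ext p q
    simp [repeatedMatrix, Matrix.diagonal_mul]
  rw [h, alphaPermanent_mul_left, Fintype.prod_sigma]
  simp

theorem hasSum_alphaPermanent_div {α : ℝ} (hα : 0 ≤ α) (hA : IsNonsingularMMatrix A)
    (hs : ∀ i, 0 ≤ s i) :
    HasSum (fun k : Fin n → ℕ => alphaPermanent α (repeatedMatrix (offDiagPart A) k) /
        ∏ i, ((A i i + s i) ^ k i * (Nat.factorial (k i) : ℝ)))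
      ((∏ i, (A i i + s i) ^ α) / (A + Matrix.diagonal s).det ^ α) := by
  obtain ⟨v, hv, hCv⟩ := exists_scaledOffDiagPart_mulVec_lt hA hs
  have hc : ∀ i, 0 ≤ (A i i + s i)⁻¹ := fun i => inv_nonneg.2 (diag_add_pos hA hs i).le
  convert hasSum_alphaPermanent_repeatedMatrix hα (scaledOffDiagPart_nonneg hA hs) hv hCv using 1
  · ext k
    rw [scaledOffDiagPart, alphaPermanent_repeatedMatrix_diagonal_mul, Finset.prod_mul_distrib]
    simp only [inv_pow, Finset.prod_inv_distrib]
    rw [div_mul_eq_div_div, div_eq_inv_mul (alphaPermanent _ _)]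
  · rw [one_sub_scaledOffDiagPart hA hs, Matrix.det_mul, Matrix.det_diagonal,
      Real.mul_rpow (Finset.prod_nonneg fun i _ => hc i) (det_add_diagonal_pos hA hs).le,
      ← Real.finsetProd_rpow _ _ fun i _ => hc i, mul_inv, div_eq_mul_inv]
    congr 1
    rw [← Finset.prod_inv_distrib]
    refine Finset.prod_congr rfl fun i _ => ?_
    rw [Real.inv_rpow (diag_add_pos hA hs i).le, inv_inv]

theorem mixtureWeight_nonneg {α : ℝ} (hα : 0 ≤ α) (hA : IsNonsingularMMatrix A) (k : Fin n → ℕ) :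
    0 ≤ mixtureWeight α A k := by
  have hd : 0 < A.det := by simpa using det_add_diagonal_pos hA (s := 0) (by simp)
  have h := fun i => (hA.diag_pos i).le
  have hp := alphaPermanent_nonneg hα (M := repeatedMatrix (offDiagPart A) k)
    fun _ _ => offDiagPart_nonneg hA _ _
  unfold mixtureWeight
  refine mul_nonneg (div_nonneg (Real.rpow_nonneg hd.le α)
    (Finset.prod_nonneg fun i _ => Real.rpow_nonneg (h i) α)) (div_nonneg hp
    (Finset.prod_nonneg fun i _ => mul_nonneg (pow_nonneg (h i) _) (Nat.cast_nonneg _)))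

/-- The powers of `aᵢ` cancel those in the weight, leaving the series of `hasSum_alphaPermanent_div`
up to a constant. -/
theorem hasSum_mixtureWeight_mul {α : ℝ} (hα : 0 ≤ α) (hA : IsNonsingularMMatrix A)
    (hs : ∀ i, 0 ≤ s i) :
    HasSum (fun k => mixtureWeight α A k * ∏ i, (A i i / (A i i + s i)) ^ (α + (k i : ℝ)))
      (A.det ^ α / (A + Matrix.diagonal s).det ^ α) := by
  have h := (hasSum_alphaPermanent_div hα hA hs).mul_left (A.det ^ α / ∏ i, (A i i + s i) ^ α)
  have hpos := diag_add_pos hA hs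
  have hne : (∏ i, (A i i + s i) ^ α) ≠ 0 :=
    Finset.prod_ne_zero_iff.2 fun i _ => (Real.rpow_pos_of_pos (hpos i) α).ne'
  have hval : A.det ^ α / (A + Matrix.diagonal s).det ^ α = (A.det ^ α / ∏ i, (A i i + s i) ^ α) *
      ((∏ i, (A i i + s i) ^ α) / (A + Matrix.diagonal s).det ^ α) := by
    field_simp
  rw [hval]
  refine Eq.mpr (congrArg (fun f => HasSum f _) (funext fun k => ?_)) h
  have h1 : ∏ i, (A i i / (A i i + s i)) ^ (α + (k i : ℝ)) =
      ((∏ i, A i i ^ α) * ∏ i, A i i ^ k i) /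
        ((∏ i, (A i i + s i) ^ α) * ∏ i, (A i i + s i) ^ k i) := by
    rw [← Finset.prod_mul_distrib, ← Finset.prod_mul_distrib, ← Finset.prod_div_distrib]
    refine Finset.prod_congr rfl fun i _ => ?_
    rw [Real.div_rpow (hA.diag_pos i).le (hpos i).le, Real.rpow_add (hA.diag_pos i),
      Real.rpow_add (hpos i), Real.rpow_natCast, Real.rpow_natCast]
  have h2 : (∏ i, A i i ^ α) ≠ 0 :=
    Finset.prod_ne_zero_iff.2 fun i _ => (Real.rpow_pos_of_pos (hA.diag_pos i) α).ne'
  have h3 : (∏ i, A i i ^ k i) ≠ 0 :=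
    Finset.prod_ne_zero_iff.2 fun i _ => (pow_pos (hA.diag_pos i) _).ne'
  have h4 : (∏ i, (A i i + s i) ^ k i) ≠ 0 :=
    Finset.prod_ne_zero_iff.2 fun i _ => (pow_pos (hpos i) _).ne'
  have h5 : (∏ i, (Nat.factorial (k i) : ℝ)) ≠ 0 :=
    Finset.prod_ne_zero_iff.2 fun i _ => by positivity
  rw [h1, mixtureWeight, Finset.prod_mul_distrib, Finset.prod_mul_distrib]
  generalize (∏ i, A i i ^ α) = x2 at *
  generalize (∏ i, A i i ^ k i) = x3 at *
  generalize (∏ i, (A i i + s i) ^ k i) = x4 at *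
  generalize (∏ i, (A i i + s i) ^ α) = x1 at *
  field_simp

theorem hasSum_mixtureWeight {α : ℝ} (hα : 0 ≤ α) (hA : IsNonsingularMMatrix A) :
    HasSum (mixtureWeight α A) 1 := by
  have hd : 0 < A.det := by simpa using det_add_diagonal_pos hA (s := 0) (by simp)
  have h := hasSum_mixtureWeight_mul hα hA (s := 0) (by simp)
  have h1 : ∀ i, A i i / A i i = 1 := fun i => div_self (hA.diag_pos i).ne'
  simpa [h1, div_self (Real.rpow_pos_of_pos hd α).ne'] using h

end MMatrix

/-! ### Laplace transform of the gamma distribution. -/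

section GammaLaplace

theorem gammaMeasure_ae_nonneg (a r : ℝ) : ∀ᵐ x ∂gammaMeasure a r, 0 ≤ x := by
  rw [ae_iff]
  simp only [not_le]
  change gammaMeasure a r (Set.Iio 0) = 0
  rw [gammaMeasure, withDensity_apply _ measurableSet_Iio, lintegral_gammaPDF_of_nonpos le_rfl]

theorem integral_exp_neg_mul_gammaMeasure {a r s : ℝ} (ha : 0 < a) (hr : 0 < r) (hs : 0 ≤ s) :
    ∫ x, Real.exp (-(s * x)) ∂gammaMeasure a r = (r / (r + s)) ^ a := by
  have hrs : 0 < r + s := by linarith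
  have hmeas : Measurable (gammaPDF a r) := (measurable_gammaPDFReal a r).ennreal_ofReal
  rw [gammaMeasure, integral_withDensity_eq_integral_toReal_smul hmeas (by simp [gammaPDF])]
  have h : (fun x => (gammaPDF a r x).toReal • Real.exp (-(s * x))) =
      (Set.Ici (0 : ℝ)).indicator fun x =>
        r ^ a / Real.Gamma a * (x ^ (a - 1) * Real.exp (-((r + s) * x))) := by
    ext x
    rw [gammaPDF, ENNReal.toReal_ofReal (gammaPDFReal_nonneg ha hr x), gammaPDFReal, smul_eq_mul]
    by_cases hx : 0 ≤ x
    · rw [if_pos hx, Set.indicator_of_mem (Set.mem_Ici.2 hx),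
        show -((r + s) * x) = -(r * x) + -(s * x) by ring, Real.exp_add]
      ring
    · rw [if_neg hx, Set.indicator_of_notMem (by simpa using hx), zero_mul]
  rw [h, integral_indicator measurableSet_Ici, integral_Ici_eq_integral_Ioi, integral_const_mul,
    Real.integral_rpow_mul_exp_neg_mul_Ioi ha hrs, Real.div_rpow zero_le_one hrs.le,
    Real.div_rpow hr.le hrs.le, Real.one_rpow]
  have := (Real.Gamma_pos_of_pos ha).ne'
  field_simp

end GammaLaplace

/-! ### Construction of the mixture and its Laplace transform. -/

section Mixture

variable {n : ℕ} {A : Matrix (Fin n) (Fin n) ℝ} {α : ℝ}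

theorem exists_isMixtureFamily (hα : 0 < α) (hA : IsNonsingularMMatrix A) :
    ∃ (Ω : Type) (_ : MeasurableSpace Ω) (P : Measure Ω) (Z : Ω → Fin n → ℕ)
      (ξ : (Fin n → ℕ) → Fin n → Ω → ℝ),
      IsProbabilityMeasure P ∧ IsMixtureFamily P α A Z ξ := by
  have hw := mixtureWeight_nonneg hα.le hA
  have hsum := hasSum_mixtureWeight hα.le hA
  let μ : PMF (Fin n → ℕ) := ⟨fun k => ENNReal.ofReal (mixtureWeight α A k), by
    rw [← ENNReal.ofReal_one, ← hsum.tsum_eq, ENNReal.ofReal_tsum_of_nonneg hw hsum.summable]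
    exact ENNReal.summable.hasSum⟩
  let ν : (Fin n → ℕ) × Fin n → Measure ℝ := fun p => gammaMeasure (α + (p.1 p.2 : ℝ)) (A p.2 p.2)
  have hν : ∀ p, IsProbabilityMeasure (ν p) := fun p =>
    isProbabilityMeasure_gammaMeasure (by positivity) (hA.diag_pos p.2)
  have hmap : ∀ p, (μ.toMeasure.prod (Measure.infinitePi ν)).map (fun ω => ω.2 p) = ν p := by
    intro p
    have h := Measure.map_map (μ := μ.toMeasure.prod (Measure.infinitePi ν))
      (measurable_pi_apply p) measurable_snd
    rw [Measure.map_snd_prod, measure_univ, one_smul, Measure.infinitePi_map_eval] at h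
    exact h.symm
  refine ⟨(Fin n → ℕ) × ((Fin n → ℕ) × Fin n → ℝ), inferInstance,
    μ.toMeasure.prod (Measure.infinitePi ν), Prod.fst, fun k i ω => ω.2 (k, i), inferInstance,
    measurable_fst, fun k => ?_, fun k i => by fun_prop, fun k i => hmap (k, i), ?_, ?_⟩
  · have h : {ω : (Fin n → ℕ) × ((Fin n → ℕ) × Fin n → ℝ) | ω.1 = k} = {k} ×ˢ Set.univ := by
      ext ω; simp
    rw [h, measureReal_def, Measure.prod_prod, measure_univ, mul_one,
      PMF.toMeasure_apply_singleton _ _ (measurableSet_singleton k)]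
    exact ENNReal.toReal_ofReal (hw k)
  · rw [iIndepFun_iff_map_fun_eq_infinitePi_map fun p => by fun_prop]
    simp only [hmap]
    exact (Measure.map_snd_prod).trans (by rw [measure_univ, one_smul])
  · exact indepFun_prod (X := id) (Y := id) measurable_id measurable_id

variable {Ω : Type*} [MeasurableSpace Ω] {P : Measure Ω}
  {Z : Ω → Fin n → ℕ} {ξ : (Fin n → ℕ) → Fin n → Ω → ℝ} {s : Fin n → ℝ}

theorem IsMixtureFamily.measurable_mixtureVector (h : IsMixtureFamily P α A Z ξ) (i : Fin n) :
    Measurable (mixtureVector Z ξ i) := by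
  have h1 : Measurable fun p : (Fin n → ℕ) × Ω => ξ p.1 i p.2 :=
    measurable_from_prod_countable_right fun k => h.measurable_ξ k i
  exact h1.comp (h.measurable_Z.prodMk measurable_id)

theorem IsMixtureFamily.integrable_exp_neg (h : IsMixtureFamily P α A Z ξ)
    [IsProbabilityMeasure P] (hs : ∀ i, 0 ≤ s i) :
    Integrable (fun ω => Real.exp (-∑ i, s i * mixtureVector Z ξ i ω)) P := by
  have hm := h.measurable_mixtureVector
  refine Integrable.of_bound (C := 1) (by fun_prop) ?_
  have h0 : ∀ᵐ ω ∂P, ∀ k i, 0 ≤ ξ k i ω := by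
    simp only [ae_all_iff]
    intro k i
    have := gammaMeasure_ae_nonneg (α + (k i : ℝ)) (A i i)
    rw [← h.law_ξ k i] at this
    exact ae_of_ae_map (h.measurable_ξ k i).aemeasurable this
  filter_upwards [h0] with ω hω
  rw [Real.norm_of_nonneg (Real.exp_pos _).le, Real.exp_le_one_iff, neg_nonpos]
  exact Finset.sum_nonneg fun i _ => mul_nonneg (hs i) (hω _ i)

theorem IsMixtureFamily.integral_exp_neg_component (hα : 0 < α) (hA : IsNonsingularMMatrix A)
    (h : IsMixtureFamily P α A Z ξ) (hs : ∀ i, 0 ≤ s i) (k : Fin n → ℕ) :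
    ∫ ω, Real.exp (-∑ i, s i * ξ k i ω) ∂P =
      ∏ i, (A i i / (A i i + s i)) ^ (α + (k i : ℝ)) := by
  have hind : iIndepFun (fun i => ξ k i) P :=
    h.indep_ξ.precomp (g := fun i : Fin n => (k, i)) fun i j hij => (Prod.mk.inj hij).2
  have h1 := hind.integral_fun_prod_comp (f := fun i x => Real.exp (-(s i * x)))
    (fun i => (h.measurable_ξ k i).aemeasurable) (fun i => by fun_prop)
  simp only [← Real.exp_sum, Finset.sum_neg_distrib] at h1
  rw [h1]
  refine Finset.prod_congr rfl fun i _ => ?_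
  rw [← integral_map (f := fun x => Real.exp (-(s i * x))) (h.measurable_ξ k i).aemeasurable
    (by fun_prop), h.law_ξ,
    integral_exp_neg_mul_gammaMeasure (by positivity) (hA.diag_pos i) (hs i)]

/-- Split the space along the events `Z = k`. On each, `X` is the vector `ξ k`, and independence of
`Z` from `ξ` factors out the probability of the event. -/
theorem IsMixtureFamily.hasSum_integral_exp_neg (hα : 0 < α) (hA : IsNonsingularMMatrix A)
    (h : IsMixtureFamily P α A Z ξ) [IsProbabilityMeasure P] (hs : ∀ i, 0 ≤ s i) :
    HasSum (fun k => mixtureWeight α A k * ∏ i, (A i i / (A i i + s i)) ^ (α + (k i : ℝ)))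
      (∫ ω, Real.exp (-∑ i, s i * mixtureVector Z ξ i ω) ∂P) := by
  have hmeas : ∀ k, MeasurableSet {ω | Z ω = k} := fun k =>
    h.measurable_Z (measurableSet_singleton k)
  have huniv : ⋃ k, {ω | Z ω = k} = Set.univ := by
    ext ω; simp
  have key := hasSum_integral_iUnion (μ := P) hmeas
    (fun k l hkl => Set.disjoint_left.2 fun ω hk hl => hkl (Eq.trans (Eq.symm hk) hl))
    (h.integrable_exp_neg hs).integrableOn
  rw [huniv, Measure.restrict_univ] at key
  refine Eq.mpr (congrArg (fun f => HasSum f _) (funext fun k => ?_)) key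
  rw [setIntegral_congr_fun (g := fun ω => Real.exp (-∑ i, s i * ξ k i ω)) (hmeas k)
    fun ω hω => by
      have hω' : Z ω = k := hω
      simp only [mixtureVector, hω']]
  have hY : Measurable fun ω (p : (Fin n → ℕ) × Fin n) => ξ p.1 p.2 ω :=
    measurable_pi_iff.2 fun p => h.measurable_ξ p.1 p.2
  have h2 := Indep.setIntegral_eq_mul (P := P) h.measurable_Z.comap_le
    (f := fun x : (Fin n → ℕ) × Fin n → ℝ => Real.exp (-∑ i, s i * x (k, i)))
    h.indep_Z_ξ hY.aemeasurable (A := {ω | Z ω = k}) ⟨{k}, measurableSet_singleton k, rfl⟩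
    (Measurable.aestronglyMeasurable (by fun_prop))
  rw [h2, h.prob_Z, ← h.integral_exp_neg_component hα hA hs k]

end Mixture

theorem theorem2p2 {n : ℕ} (α : ℝ) (hα : 0 < α) (A : Matrix (Fin n) (Fin n) ℝ)
    (hA : IsNonsingularMMatrix A) :
    -- the weights are a probability distribution on `ℕⁿ`
    ((∀ k, 0 ≤ mixtureWeight α A k) ∧ HasSum (mixtureWeight α A) 1) ∧
    -- the random variables `Z` and `ξ` exist on some probability space
    (∃ (Ω : Type) (_ : MeasurableSpace Ω) (P : Measure Ω) (Z : Ω → Fin n → ℕ)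
      (ξ : (Fin n → ℕ) → Fin n → Ω → ℝ),
      IsProbabilityMeasure P ∧ IsMixtureFamily P α A Z ξ) ∧
    -- the determinants whose powers are taken are positive
    (0 < A.det ∧
      ∀ s : Fin n → ℝ, (∀ i, 0 ≤ s i) → 0 < (A + Matrix.diagonal s).det) ∧
    -- the Laplace transform of `X`, whatever the probability space
    (∀ (Ω : Type*) [MeasurableSpace Ω] (P : Measure Ω) [IsProbabilityMeasure P]
      (Z : Ω → Fin n → ℕ) (ξ : (Fin n → ℕ) → Fin n → Ω → ℝ),
      IsMixtureFamily P α A Z ξ →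
      ∀ s : Fin n → ℝ, (∀ i, 0 ≤ s i) →
        Integrable (fun ω => Real.exp (-∑ i, s i * mixtureVector Z ξ i ω)) P ∧
        ∫ ω, Real.exp (-∑ i, s i * mixtureVector Z ξ i ω) ∂P =
          A.det ^ α / (A + Matrix.diagonal s).det ^ α) := by
  refine ⟨⟨mixtureWeight_nonneg hα.le hA, hasSum_mixtureWeight hα.le hA⟩,
    exists_isMixtureFamily hα hA,
    ⟨by simpa using det_add_diagonal_pos hA (s := 0) (by simp),
      fun s hs => det_add_diagonal_pos hA hs⟩, ?_⟩
  intro Ω _ P _ Z ξ h s hs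
  exact ⟨h.integrable_exp_neg hs,
    (h.hasSum_integral_exp_neg hα hA hs).unique (hasSum_mixtureWeight_mul hα.le hA hs)⟩
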